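/- Let $K$ be a commutative ring and let $\varphi\colon B\to A$ be a homomorphism of associative unital $K$-algebras (an algebra extension $A\,\|\,B$), so that $A$ is a $B$-$B$-bimodule. Let $R=C_A(B)$ be the centralizer of $\varphi(B)$ in $A$, let $\mathcal E=\mathrm{End}({}_BA)$ and $S=\mathrm{End}({}_BA_B)\subseteq\mathcal E$ (with composition as product), and let $T=(A\otimes_BA)^B$ be the set of $t=t^1\otimes t^2\in A\otimes_B A$ (summation suppressed) with $bt=tb$ for all $b\in B$. Put $\lambda(r)(x)=rx$ and $\rho(a)(x)=xa$. Suppose that $A\,\|\,B$ is right D2, i.e. $A\otimes_BA$ is isomorphic, as an $A$-$B$-bimodule, to a direct summand of $A^n$ for some $n$. Then there is a right D2 quasibase, i.e. there are finitely many $\gamma_j\in S$, $u_j=u_j^1\otimes u_j^2\in T$ with $$a\otimes_B a'=\sum_j a\,\gamma_j(a')\,u_j\qquad(a,a'\in A),$$ and the maps $$\Delta\colon S\to S\otimes_RS,\ \ \Delta(\alpha)=\sum_j\gamma_j\otimes u_j^1\alpha(u_j^2-),\qquad \varrho\colon\mathcal E\to S\otimes_R\mathcal E,\ \ \varrho(f)=\sum_j\gamma_j\otimes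 u_j^1f(u_j^2-),$$ do not depend on its choice. Here the tensor products are formed with respect to $\alpha\cdot r=\rho(r)\alpha$ on $S$ and $r\cdot f=\lambda(r)f$ on $S$ and $\mathcal E$. Moreover: 1. $S$ is a left $R$-bialgebroid with source map $\lambda\colon R\to S$, target map $\rho\colon R^{\mathrm{op}}\to S$, comultiplication $\Delta$ and counit $\varepsilon(\alpha)=\alpha(1)$. That is, $S$ is an $R$-coring for the bimodule structure $r\cdot\alpha\cdot r'=\lambda(r)\rho(r')\alpha$ (so $\Delta$ and $\varepsilon$ are $R$-bimodule maps, $\Delta$ is coassociative and $\varepsilon$ is a counit), $\Delta(\alpha)(\rho(r)\otimes1)=\Delta(\alpha)(1\otimes\lambda(r))$, $\Delta(\alpha\beta)=\Delta(\alpha)\Delta(\beta)$, $\Delta(1)=1\otimes1$, $\varepsilon(1)=1$ and $\varepsilon(\alpha\beta)=\varepsilon(\alpha\lambda(\varepsilon(\beta)))=\varepsilon(\alpha\rho(\varepsilon(\beta)))$. 2. $\mathcal E$, with the algebra homomorphism $\lambda\colon R\to\mathcal E$ and the coaction $\varrho$, is a left $S$-comodule algebra. That is, $\varrho$ is left $R$-linear,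 coassociative and counital, $\varrho(1)=1\otimes 1$, $\varrho(f)(\rho(r)\otimes1)=\varrho(f)(1\otimes\lambda(r))$ for $r\in R$, and $\varrho(fg)=\varrho(f)\varrho(g)$. 3. The subalgebra of coinvariants $\{f\in\mathcal E:\varrho(f)=1\otimes f\}$ equals $\rho(A)$, and $a\mapsto\rho(a)$ is an algebra isomorphism from $A^{\mathrm{op}}$ onto it. 4. The Galois map $$\beta\colon\mathcal E\otimes_{\rho(A)}\mathcal E\to S\otimes_R\mathcal E,\qquad\beta(f\otimes g)=\varrho(f)(1\otimes g),$$ is bijective; that is, $\mathcal E$ is a left $S$-Galois extension of $\rho(A)$. -/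

import Mathlib

open scoped TensorProduct

noncomputable section

/-! ### Tensor products over a noncommutative base algebra

A right `R`-module structure on a `K`-module `M` is given as an algebra homomorphism
`p : Rᵐᵒᵖ →ₐ[K] Module.End K M`, with `m · r = p (op r) m`, and a left `R`-module structure on `N`
as an algebra homomorphism `q : R →ₐ[K] Module.End K N`, with `r · n = q r n`. -/

namespace BalTensor

variable {K R M N P M' N' : Type*} [CommRing K] [Ring R] [Algebra K R]
  [AddCommGroup M] [Module K M] [AddCommGroup N] [Module K N] [AddCommGroup P] [Module K P]
  [AddCommGroup M'] [Module K M'] [AddCommGroup N'] [Module K N']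

/-- The submodule of `M ⊗[K] N` spanned by the elements `(m · r) ⊗ n - m ⊗ (r · n)`. -/
def relations (p : Rᵐᵒᵖ →ₐ[K] Module.End K M) (q : R →ₐ[K] Module.End K N) :
    Submodule K (M ⊗[K] N) :=
  Submodule.span K {z | ∃ (r : R) (m : M) (n : N),
    z = p (MulOpposite.op r) m ⊗ₜ[K] n - m ⊗ₜ[K] q r n}

end BalTensor

/-- The tensor product `M ⊗_R N` of a right `R`-module `M` and a left `R`-module `N`. -/
abbrev BalTensor {K R M N : Type*} [CommRing K] [Ring R] [Algebra K R]
    [AddCommGroup M] [Module K M] [AddCommGroup N] [Module K N]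
    (p : Rᵐᵒᵖ →ₐ[K] Module.End K M) (q : R →ₐ[K] Module.End K N) :=
  (M ⊗[K] N) ⧸ BalTensor.relations p q

namespace BalTensor

variable {K R M N P M' N' : Type*} [CommRing K] [Ring R] [Algebra K R]
  [AddCommGroup M] [Module K M] [AddCommGroup N] [Module K N] [AddCommGroup P] [Module K P]
  [AddCommGroup M'] [Module K M'] [AddCommGroup N'] [Module K N']

/-- The elementary tensors `m ⊗ n` of `M ⊗_R N`. -/
def mk (p : Rᵐᵒᵖ →ₐ[K] Module.End K M) (q : R →ₐ[K] Module.End K N) :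
    M →ₗ[K] N →ₗ[K] BalTensor p q :=
  (TensorProduct.mk K M N).compr₂ (relations p q).mkQ

theorem mk_smul {p : Rᵐᵒᵖ →ₐ[K] Module.End K M} {q : R →ₐ[K] Module.End K N}
    (r : R) (m : M) (n : N) : mk p q (p (MulOpposite.op r) m) n = mk p q m (q r n) :=
  (Submodule.Quotient.eq _).2 (Submodule.subset_span ⟨r, m, n, rfl⟩)

/-- The linear map `M ⊗_R N → P`, `m ⊗ n ↦ f m n`, induced by an `R`-balanced map `f`. -/
def lift {p : Rᵐᵒᵖ →ₐ[K] Module.End K M} {q : R →ₐ[K] Module.End K N}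
    (f : M →ₗ[K] N →ₗ[K] P)
    (hf : ∀ (r : R) (m : M) (n : N), f (p (MulOpposite.op r) m) n = f m (q r n)) :
    BalTensor p q →ₗ[K] P :=
  (relations p q).liftQ (TensorProduct.lift f) (by
    refine Submodule.span_le.2 ?_
    rintro _ ⟨r, m, n, rfl⟩
    simp [hf])

@[simp]
theorem lift_mk {p : Rᵐᵒᵖ →ₐ[K] Module.End K M} {q : R →ₐ[K] Module.End K N}
    (f : M →ₗ[K] N →ₗ[K] P)
    (hf : ∀ (r : R) (m : M) (n : N), f (p (MulOpposite.op r) m) n = f m (q r n))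
    (m : M) (n : N) : lift f hf (mk p q m n) = f m n :=
  TensorProduct.lift.tmul m n

theorem hom_ext {p : Rᵐᵒᵖ →ₐ[K] Module.End K M} {q : R →ₐ[K] Module.End K N}
    {f g : BalTensor p q →ₗ[K] P} (h : ∀ m n, f (mk p q m n) = g (mk p q m n)) : f = g :=
  Submodule.linearMap_qext _ (TensorProduct.ext' h)

/-- The map `f ⊗ g : M ⊗_R N → M' ⊗_R N'` for `R`-linear `f` and `g`. -/
def map {p : Rᵐᵒᵖ →ₐ[K] Module.End K M} {q : R →ₐ[K] Module.End K N}
    {p' : Rᵐᵒᵖ →ₐ[K] Module.End K M'} {q' : R →ₐ[K] Module.End K N'}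
    (f : M →ₗ[K] M') (g : N →ₗ[K] N')
    (hf : ∀ (r : R) (m : M), f (p (MulOpposite.op r) m) = p' (MulOpposite.op r) (f m))
    (hg : ∀ (r : R) (n : N), g (q r n) = q' r (g n)) :
    BalTensor p q →ₗ[K] BalTensor p' q' :=
  lift ((mk p' q').compl₁₂ f g) (fun r m n => by simp [hf, hg, mk_smul])

@[simp]
theorem map_mk {p : Rᵐᵒᵖ →ₐ[K] Module.End K M} {q : R →ₐ[K] Module.End K N}
    {p' : Rᵐᵒᵖ →ₐ[K] Module.End K M'} {q' : R →ₐ[K] Module.End K N'}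
    (f : M →ₗ[K] M') (g : N →ₗ[K] N')
    (hf : ∀ (r : R) (m : M), f (p (MulOpposite.op r) m) = p' (MulOpposite.op r) (f m))
    (hg : ∀ (r : R) (n : N), g (q r n) = q' r (g n)) (m : M) (n : N) :
    map f g hf hg (mk p q m n) = mk p' q' (f m) (g n) := by
  simp [map]

/-- If `M` is an `L`-`R`-bimodule, then `M ⊗_R N` is a left `L`-module, `l · (m ⊗ n) = l m ⊗ n`. -/
def leftAction {L : Type*} [Ring L] [Algebra K L]
    (l : L →ₐ[K] Module.End K M) (p : Rᵐᵒᵖ →ₐ[K] Module.End K M) (q : R →ₐ[K] Module.End K N)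
    (hl : ∀ (x : L) (r : Rᵐᵒᵖ) (m : M), l x (p r m) = p r (l x m)) :
    L →ₐ[K] Module.End K (BalTensor p q) :=
  AlgHom.ofLinearMap
    { toFun := fun x => map (l x) LinearMap.id (fun _ _ => hl _ _ _) (fun _ _ => rfl)
      map_add' := fun x y => hom_ext fun m n => by simp
      map_smul' := fun c x => hom_ext fun m n => by simp }
    (hom_ext fun m n => by simp)
    (fun x y => hom_ext fun m n => by simp)

/-- If `N` is an `R`-`L`-bimodule, then `M ⊗_R N` is a right `L`-module, `(m ⊗ n) · l = m ⊗ n l`. -/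
def rightAction {L : Type*} [Ring L] [Algebra K L]
    (p : Rᵐᵒᵖ →ₐ[K] Module.End K M) (q : R →ₐ[K] Module.End K N) (l : Lᵐᵒᵖ →ₐ[K] Module.End K N)
    (hl : ∀ (x : Lᵐᵒᵖ) (r : R) (n : N), l x (q r n) = q r (l x n)) :
    Lᵐᵒᵖ →ₐ[K] Module.End K (BalTensor p q) :=
  AlgHom.ofLinearMap
    { toFun := fun x => map LinearMap.id (l x) (fun _ _ => rfl) (fun _ _ => hl _ _ _)
      map_add' := fun x y => hom_ext fun m n => by simp
      map_smul' := fun c x => hom_ext fun m n => by simp }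
    (hom_ext fun m n => by simp)
    (fun x y => hom_ext fun m n => by simp)

end BalTensor

/-- `Aᵐᵒᵖ → End_K A`, the right regular module of `A`: `op a` acts by `x ↦ x * a`. -/
def rightMul (K A : Type*) [CommRing K] [Ring A] [Algebra K A] : Aᵐᵒᵖ →ₐ[K] Module.End K A :=
  Algebra.lsmul K K A

@[simp]
theorem rightMul_apply {K A : Type*} [CommRing K] [Ring A] [Algebra K A] (a : Aᵐᵒᵖ) (x : A) :
    rightMul K A a x = x * a.unop := rfl

/-! ### Left bialgebroids, comodule algebras and Galois extensions -/

/-- Commuting source and target maps `R → H`, an algebra homomorphism and an anti-homomorphism. -/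
structure SourceTarget (K R H : Type*) [CommRing K] [Ring R] [Algebra K R] [Ring H]
    [Algebra K H] where
  s : R →ₐ[K] H
  t : Rᵐᵒᵖ →ₐ[K] H
  comm : ∀ (r : R) (r' : Rᵐᵒᵖ), s r * t r' = t r' * s r

namespace SourceTarget

variable {K R H C : Type*} [CommRing K] [Ring R] [Algebra K R] [Ring H] [Algebra K H]
  [Ring C] [Algebra K C]

/-- The left `R`-module `r · c = η(r) c` on an algebra `C` with algebra homomorphism `η : R → C`. -/
def leftModule (η : R →ₐ[K] C) : R →ₐ[K] Module.End K C := (Algebra.lmul K C).comp η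

@[simp]
theorem leftModule_apply (η : R →ₐ[K] C) (r : R) (c : C) : leftModule η r c = η r * c := rfl

/-- The right `R`-module `x · r = t(r) x` on `H`. -/
def rightModule (st : SourceTarget K R H) : Rᵐᵒᵖ →ₐ[K] Module.End K H :=
  (Algebra.lmul K H).comp st.t

@[simp]
theorem rightModule_apply (st : SourceTarget K R H) (r : Rᵐᵒᵖ) (x : H) :
    st.rightModule r x = st.t r * x := rfl

/-- `H ⊗_R C`, where `H` is the right `R`-module `x · r = t(r) x` and `C` the left `R`-module
`r · c = η(r) c`. In particular `st.Tensor st.s` is `H ⊗_R H` for the `R`-`R`-bimodule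
`r · x · r' = t(r') s(r) x`. -/
abbrev Tensor (st : SourceTarget K R H) (η : R →ₐ[K] C) :=
  BalTensor st.rightModule (leftModule η)

/-- The elementary tensors of `H ⊗_R C`. -/
abbrev tmul (st : SourceTarget K R H) (η : R →ₐ[K] C) : H →ₗ[K] C →ₗ[K] st.Tensor η :=
  BalTensor.mk st.rightModule (leftModule η)

theorem tensor_ext {P : Type*} [AddCommGroup P] [Module K P] {st : SourceTarget K R H}
    {η : R →ₐ[K] C} {f g : st.Tensor η →ₗ[K] P}
    (h : ∀ x c, f (st.tmul η x c) = g (st.tmul η x c)) : f = g :=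
  BalTensor.hom_ext h

/-- The left `R`-module `r · (x ⊗ c) = s(r) x ⊗ c` on `H ⊗_R C`. -/
def tensorLeft (st : SourceTarget K R H) (η : R →ₐ[K] C) :
    R →ₐ[K] Module.End K (st.Tensor η) :=
  BalTensor.leftAction (leftModule st.s) st.rightModule (leftModule η)
    (fun x r m => by simp [← mul_assoc, st.comm])

@[simp]
theorem tensorLeft_tmul (st : SourceTarget K R H) (η : R →ₐ[K] C) (r : R) (x : H) (c : C) :
    st.tensorLeft η r (st.tmul η x c) = st.tmul η (st.s r * x) c := rfl

/-- The right `R`-module `(x ⊗ y) · r = x ⊗ t(r) y` on `H ⊗_R H`. -/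
def tensorRight (st : SourceTarget K R H) : Rᵐᵒᵖ →ₐ[K] Module.End K (st.Tensor st.s) :=
  BalTensor.rightAction st.rightModule (leftModule st.s) st.rightModule
    (fun x r m => by simp [← mul_assoc, st.comm])

@[simp]
theorem tensorRight_tmul (st : SourceTarget K R H) (r : Rᵐᵒᵖ) (x y : H) :
    st.tensorRight r (st.tmul st.s x y) = st.tmul st.s x (st.t r * y) := rfl

/-- `z ↦ z (y ⊗ d)` on `H ⊗_R C`, that is, `x ⊗ c ↦ x y ⊗ c d`. -/
def mulPure (st : SourceTarget K R H) (η : R →ₐ[K] C) (y : H) (d : C) :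
    st.Tensor η →ₗ[K] st.Tensor η :=
  BalTensor.map (LinearMap.mulRight K y) (LinearMap.mulRight K d)
    (fun r m => by simp [mul_assoc]) (fun r n => by simp [mul_assoc])

@[simp]
theorem mulPure_tmul (st : SourceTarget K R H) (η : R →ₐ[K] C) (x y : H) (c d : C) :
    st.mulPure η y d (st.tmul η x c) = st.tmul η (x * y) (c * d) :=
  BalTensor.map_mk _ _ _ _ _ _

theorem mulPure_add_left (st : SourceTarget K R H) (η : R →ₐ[K] C) (y y' : H) (d : C) :
    st.mulPure η (y + y') d = st.mulPure η y d + st.mulPure η y' d :=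
  tensor_ext fun x c => by
    simp only [LinearMap.add_apply, mulPure_tmul, mul_add, map_add]

theorem mulPure_smul_left (st : SourceTarget K R H) (η : R →ₐ[K] C) (k : K) (y : H) (d : C) :
    st.mulPure η (k • y) d = k • st.mulPure η y d :=
  tensor_ext fun x c => by
    simp only [LinearMap.smul_apply, mulPure_tmul, mul_smul_comm, map_smul]

theorem mulPure_add_right (st : SourceTarget K R H) (η : R →ₐ[K] C) (y : H) (d d' : C) :
    st.mulPure η y (d + d') = st.mulPure η y d + st.mulPure η y d' :=
  tensor_ext fun x c => by
    simp only [LinearMap.add_apply, mulPure_tmul, mul_add, map_add]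

theorem mulPure_smul_right (st : SourceTarget K R H) (η : R →ₐ[K] C) (k : K) (y : H) (d : C) :
    st.mulPure η y (k • d) = k • st.mulPure η y d :=
  tensor_ext fun x c => by
    simp only [LinearMap.smul_apply, mulPure_tmul, mul_smul_comm, map_smul]

theorem mulPure_mul (st : SourceTarget K R H) (η : R →ₐ[K] C) (a b : H) (c d : C) :
    st.mulPure η (a * b) (c * d) = st.mulPure η b d ∘ₗ st.mulPure η a c :=
  tensor_ext fun x c => by
    simp only [LinearMap.comp_apply, mulPure_tmul, mul_assoc]

/-- The condition `z (t(r) ⊗ 1) = z (1 ⊗ η(r))` for all `r`, under which left multiplication by `z`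
is well defined on `H ⊗_R C`. -/
def IsTakeuchi (st : SourceTarget K R H) (η : R →ₐ[K] C) (z : st.Tensor η) : Prop :=
  ∀ r : R, st.mulPure η (st.t (MulOpposite.op r)) 1 z = st.mulPure η 1 (η r) z

/-- `w ↦ z w` on `H ⊗_R C`, with the factorwise product, for `z` as in `IsTakeuchi`. -/
def tensorMul (st : SourceTarget K R H) (η : R →ₐ[K] C) (z : st.Tensor η)
    (hz : st.IsTakeuchi η z) : st.Tensor η →ₗ[K] st.Tensor η :=
  BalTensor.lift
    (LinearMap.mk₂ K (fun y d => st.mulPure η y d z)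
      (fun y y' d => by rw [mulPure_add_left, LinearMap.add_apply])
      (fun k y d => by rw [mulPure_smul_left, LinearMap.smul_apply])
      (fun y d d' => by rw [mulPure_add_right, LinearMap.add_apply])
      (fun k y d => by rw [mulPure_smul_right, LinearMap.smul_apply]))
    (fun r y d => by
      have h1 := LinearMap.congr_fun (st.mulPure_mul η (st.t (MulOpposite.op r)) y 1 d) z
      have h2 := LinearMap.congr_fun (st.mulPure_mul η 1 y (η r) d) z
      rw [one_mul, LinearMap.comp_apply] at h1 h2
      rw [hz r] at h1
      exact h1.trans h2.symm)

@[simp]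
theorem tensorMul_tmul (st : SourceTarget K R H) (η : R →ₐ[K] C) (z : st.Tensor η)
    (hz : st.IsTakeuchi η z) (y : H) (d : C) :
    st.tensorMul η z hz (st.tmul η y d) = st.mulPure η y d z :=
  BalTensor.lift_mk _ _ _ _

/-- `H ⊗_R (H ⊗_R C)`. -/
abbrev Tensor₃ (st : SourceTarget K R H) (η : R →ₐ[K] C) :=
  BalTensor st.rightModule (st.tensorLeft η)

/-- `(x ⊗ y) ↦ x ⊗ (y ⊗ c)`, as a map `H ⊗_R H → H ⊗_R (H ⊗_R C)`, linear in `c`. -/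
def appendTensor (st : SourceTarget K R H) (η : R →ₐ[K] C) (c : C) :
    st.Tensor st.s →ₗ[K] st.Tensor₃ η :=
  BalTensor.map LinearMap.id ((st.tmul η).flip c) (fun _ _ => rfl)
    (fun r y => (st.tensorLeft_tmul η r y c).symm)

theorem appendTensor_tmul (st : SourceTarget K R H) (η : R →ₐ[K] C) (c : C) (x y : H) :
    st.appendTensor η c (st.tmul st.s x y) =
      BalTensor.mk st.rightModule (st.tensorLeft η) x (st.tmul η y c) :=
  BalTensor.map_mk _ _ _ _ _ _

theorem appendTensor_add (st : SourceTarget K R H) (η : R →ₐ[K] C) (c c' : C) :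
    st.appendTensor η (c + c') = st.appendTensor η c + st.appendTensor η c' :=
  tensor_ext fun x y => by
    simp only [LinearMap.add_apply, appendTensor_tmul, map_add]

theorem appendTensor_smul (st : SourceTarget K R H) (η : R →ₐ[K] C) (k : K) (c : C) :
    st.appendTensor η (k • c) = k • st.appendTensor η c :=
  tensor_ext fun x y => by
    simp only [LinearMap.smul_apply, appendTensor_tmul, map_smul]

theorem appendTensor_balanced (st : SourceTarget K R H) (η : R →ₐ[K] C) (r : R) (c : C) :
    st.appendTensor η c ∘ₗ st.tensorRight (MulOpposite.op r) = st.appendTensor η (η r * c) :=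
  tensor_ext fun x y => by
    rw [LinearMap.comp_apply, tensorRight_tmul, appendTensor_tmul, appendTensor_tmul]
    congr 1
    exact BalTensor.mk_smul (p := st.rightModule) (q := leftModule η) r y c

/-- `Δ ⊗ id : H ⊗_R C → H ⊗_R H ⊗_R C` for a right `R`-linear map `Δ : H → H ⊗_R H`. -/
def comulTensor (st : SourceTarget K R H) (η : R →ₐ[K] C) (Δ : H →ₗ[K] st.Tensor st.s)
    (hΔ : ∀ (r : Rᵐᵒᵖ) (x : H), Δ (st.t r * x) = st.tensorRight r (Δ x)) :
    st.Tensor η →ₗ[K] st.Tensor₃ η :=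
  BalTensor.lift
    (LinearMap.mk₂ K (fun x c => st.appendTensor η c (Δ x))
      (fun x x' c => by rw [map_add, map_add])
      (fun k x c => by rw [map_smul, map_smul])
      (fun x c c' => by rw [appendTensor_add, LinearMap.add_apply])
      (fun k x c => by rw [appendTensor_smul, LinearMap.smul_apply]))
    (fun r x c => by
      have h := LinearMap.congr_fun (st.appendTensor_balanced η r c) (Δ x)
      rw [LinearMap.comp_apply, ← hΔ] at h
      exact h)

/-- `id ⊗ δ : H ⊗_R C → H ⊗_R (H ⊗_R C)` for a left `R`-linear map `δ : C → H ⊗_R C`. -/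
def tensorCoact (st : SourceTarget K R H) (η : R →ₐ[K] C) (δ : C →ₗ[K] st.Tensor η)
    (hδ : ∀ (r : R) (c : C), δ (η r * c) = st.tensorLeft η r (δ c)) :
    st.Tensor η →ₗ[K] st.Tensor₃ η :=
  BalTensor.map LinearMap.id δ (fun _ _ => rfl) hδ

/-- `ε ⊗ id : H ⊗_R C → C`, `x ⊗ c ↦ η(ε(x)) c`, for a right `R`-linear map `ε : H → R`. -/
def counitTensor (st : SourceTarget K R H) (η : R →ₐ[K] C) (ε : H →ₗ[K] R)
    (hε : ∀ (r : Rᵐᵒᵖ) (x : H), ε (st.t r * x) = ε x * r.unop) :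
    st.Tensor η →ₗ[K] C :=
  BalTensor.lift ((LinearMap.mul K C).comp (η.toLinearMap.comp ε))
    (fun r x c => by simp [hε, mul_assoc])

/-- `id ⊗ ε : H ⊗_R H → H`, `x ⊗ y ↦ t(ε(y)) x`, for a left `R`-linear map `ε : H → R`. -/
def tensorCounit (st : SourceTarget K R H) (ε : H →ₗ[K] R)
    (hε : ∀ (r : R) (x : H), ε (st.s r * x) = r * ε x) :
    st.Tensor st.s →ₗ[K] H :=
  BalTensor.lift
    ((LinearMap.mul K H).comp
      (st.t.toLinearMap.comp ((MulOpposite.opLinearEquiv K).toLinearMap.comp ε))).flip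
    (fun r x c => by simp [hε, mul_assoc])

/-- `(H, R, s, t, Δ, ε)` is a left `R`-bialgebroid. -/
structure IsLeftBialgebroid (st : SourceTarget K R H) (Δ : H →ₗ[K] st.Tensor st.s)
    (ε : H →ₗ[K] R) : Prop where
  comul_left : ∀ (r : R) (x : H), Δ (st.s r * x) = st.tensorLeft st.s r (Δ x)
  comul_right : ∀ (r : Rᵐᵒᵖ) (x : H), Δ (st.t r * x) = st.tensorRight r (Δ x)
  counit_left : ∀ (r : R) (x : H), ε (st.s r * x) = r * ε x
  counit_right : ∀ (r : Rᵐᵒᵖ) (x : H), ε (st.t r * x) = ε x * r.unop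
  coassoc : ∀ x : H, st.comulTensor st.s Δ comul_right (Δ x) =
    st.tensorCoact st.s Δ comul_left (Δ x)
  counit_comul : ∀ x : H, st.counitTensor st.s ε counit_right (Δ x) = x
  comul_counit : ∀ x : H, st.tensorCounit ε counit_left (Δ x) = x
  takeuchi : ∀ x : H, st.IsTakeuchi st.s (Δ x)
  comul_mul : ∀ x y : H, Δ (x * y) = st.tensorMul st.s (Δ x) (takeuchi x) (Δ y)
  comul_one : Δ 1 = st.tmul st.s 1 1
  counit_one : ε 1 = 1
  counit_mul_source : ∀ x y : H, ε (x * y) = ε (x * st.s (ε y))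
  counit_mul_target : ∀ x y : H, ε (x * y) = ε (x * st.t (MulOpposite.op (ε y)))

/-- The algebra `C`, with the algebra homomorphism `η : R → C` and the coaction
`δ : C → H ⊗_R C`, is a left comodule algebra over the left bialgebroid `H`. -/
structure IsLeftComoduleAlgebra {st : SourceTarget K R H} {Δ : H →ₗ[K] st.Tensor st.s}
    {ε : H →ₗ[K] R} (hH : st.IsLeftBialgebroid Δ ε) (η : R →ₐ[K] C)
    (δ : C →ₗ[K] st.Tensor η) : Prop where
  coact_left : ∀ (r : R) (c : C), δ (η r * c) = st.tensorLeft η r (δ c)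
  coassoc : ∀ c : C, st.comulTensor η Δ hH.comul_right (δ c) = st.tensorCoact η δ coact_left (δ c)
  counit_coact : ∀ c : C, st.counitTensor η ε hH.counit_right (δ c) = c
  coact_one : δ 1 = st.tmul η 1 1
  takeuchi : ∀ c : C, st.IsTakeuchi η (δ c)
  coact_mul : ∀ c d : C, δ (c * d) = st.tensorMul η (δ c) (takeuchi c) (δ d)

namespace IsLeftComoduleAlgebra

variable {st : SourceTarget K R H} {Δ : H →ₗ[K] st.Tensor st.s} {ε : H →ₗ[K] R}
  {hH : st.IsLeftBialgebroid Δ ε} {η : R →ₐ[K] C} {δ : C →ₗ[K] st.Tensor η}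

/-- The subalgebra of coinvariants `{c | δ c = 1 ⊗ c}`. -/
def coinvariants (hC : IsLeftComoduleAlgebra hH η δ) : Subalgebra K C where
  carrier := {c | δ c = st.tmul η 1 c}
  mul_mem' := fun {c d} hc hd => by
    simp only [Set.mem_ofPred_eq] at hc hd ⊢
    rw [hC.coact_mul, hd, tensorMul_tmul, hc, mulPure_tmul, one_mul]
  add_mem' := fun {c d} hc hd => by
    simp only [Set.mem_ofPred_eq] at hc hd ⊢
    rw [map_add, hc, hd, map_add]
  algebraMap_mem' := fun k => by
    simp only [Set.mem_ofPred_eq, Algebra.algebraMap_eq_smul_one, map_smul, hC.coact_one]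

/-- `C ⊗_D C`, where `D` is the subalgebra of coinvariants. -/
abbrev CoinvTensor (hC : IsLeftComoduleAlgebra hH η δ) :=
  BalTensor ((rightMul K C).comp (AlgHom.op hC.coinvariants.val)) (leftModule hC.coinvariants.val)

/-- The Galois map `C ⊗_D C → H ⊗_R C`, `c ⊗ c' ↦ δ(c) (1 ⊗ c')`. -/
def galoisMap (hC : IsLeftComoduleAlgebra hH η δ) : hC.CoinvTensor →ₗ[K] st.Tensor η :=
  BalTensor.lift
    (LinearMap.mk₂ K (fun c c' => st.mulPure η 1 c' (δ c))
      (fun c d c' => by rw [map_add, map_add])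
      (fun k c c' => by rw [map_smul, map_smul])
      (fun c d d' => by rw [mulPure_add_right, LinearMap.add_apply])
      (fun k c d => by rw [mulPure_smul_right, LinearMap.smul_apply]))
    (fun d c c' => by
      have hd : δ d = st.tmul η 1 (d : C) := d.2
      have h := LinearMap.congr_fun (st.mulPure_mul η 1 1 (d : C) c') (δ c)
      have h2 : δ (c * d) = st.mulPure η 1 (d : C) (δ c) := by
        rw [hC.coact_mul, hd, tensorMul_tmul]
      rw [one_mul, LinearMap.comp_apply, ← h2] at h
      exact h.symm)

/-- `C` is a left `H`-Galois extension of its coinvariants. -/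
def IsGalois (hC : IsLeftComoduleAlgebra hH η δ) : Prop := Function.Bijective hC.galoisMap

end IsLeftComoduleAlgebra

end SourceTarget

/-! ### Algebra extensions and depth two -/

/-- A bimodule `M` (over algebras `A` and `B`) is centrally projective with respect to a bimodule
`N` if `M` is isomorphic to a direct summand of some finite direct sum of copies of `N`, that is,
if there are bimodule maps `i : M → N^n` and `p : N^n → M` with `p ∘ i = id`. -/
def IsCentrallyProjective {K A B M N : Type*} [CommRing K] [Ring A] [Algebra K A] [Ring B]
    [Algebra K B] [AddCommGroup M] [Module K M] [AddCommGroup N] [Module K N]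
    (lM : A →ₐ[K] Module.End K M) (rM : Bᵐᵒᵖ →ₐ[K] Module.End K M)
    (lN : A →ₐ[K] Module.End K N) (rN : Bᵐᵒᵖ →ₐ[K] Module.End K N) : Prop :=
  ∃ (n : ℕ) (i : M →ₗ[K] (Fin n → N)) (p : (Fin n → N) →ₗ[K] M),
    (∀ (a : A) (m : M), i (lM a m) = fun k => lN a (i m k)) ∧
    (∀ (b : Bᵐᵒᵖ) (m : M), i (rM b m) = fun k => rN b (i m k)) ∧
    (∀ (a : A) (v : Fin n → N), p (fun k => lN a (v k)) = lM a (p v)) ∧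
    (∀ (b : Bᵐᵒᵖ) (v : Fin n → N), p (fun k => rN b (v k)) = rM b (p v)) ∧
    ∀ m : M, p (i m) = m

namespace AlgExt

/-! An algebra extension `A ∥ B` is an algebra homomorphism `φ : B →ₐ[K] A`. -/

variable {K A B : Type*} [CommRing K] [Ring A] [Algebra K A] [Ring B] [Algebra K B]

/-- The natural left `B`-module `A`. -/
def leftB (φ : B →ₐ[K] A) : B →ₐ[K] Module.End K A := (Algebra.lmul K A).comp φ

@[simp]
theorem leftB_apply (φ : B →ₐ[K] A) (b : B) (a : A) : leftB φ b a = φ b * a := rfl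

/-- The natural right `B`-module `A`. -/
def rightB (φ : B →ₐ[K] A) : Bᵐᵒᵖ →ₐ[K] Module.End K A := (rightMul K A).comp (AlgHom.op φ)

@[simp]
theorem rightB_apply (φ : B →ₐ[K] A) (b : Bᵐᵒᵖ) (a : A) : rightB φ b a = a * φ b.unop := rfl

/-- The tensor-square `A ⊗_B A`. -/
abbrev TensorSq (φ : B →ₐ[K] A) := BalTensor (rightB φ) (leftB φ)

/-- The left `A`-module `a · (x ⊗ y) = a x ⊗ y` on the tensor-square. -/
def sqLeft (φ : B →ₐ[K] A) : A →ₐ[K] Module.End K (TensorSq φ) :=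
  BalTensor.leftAction (Algebra.lmul K A) (rightB φ) (leftB φ) (fun x r m => by simp [mul_assoc])

/-- The right `A`-module `(x ⊗ y) · a = x ⊗ y a` on the tensor-square. -/
def sqRight (φ : B →ₐ[K] A) : Aᵐᵒᵖ →ₐ[K] Module.End K (TensorSq φ) :=
  BalTensor.rightAction (rightB φ) (leftB φ) (rightMul K A) (fun x r m => by simp [mul_assoc])

@[simp]
theorem sqLeft_mk (φ : B →ₐ[K] A) (a x y : A) :
    sqLeft φ a (BalTensor.mk (rightB φ) (leftB φ) x y) = BalTensor.mk _ _ (a * x) y := rfl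

@[simp]
theorem sqRight_mk (φ : B →ₐ[K] A) (a : Aᵐᵒᵖ) (x y : A) :
    sqRight φ a (BalTensor.mk (rightB φ) (leftB φ) x y) = BalTensor.mk _ _ x (y * a.unop) := rfl

/-- `A ∥ B` is right D2: the tensor-square `A ⊗_B A` is centrally projective with respect to `A`,
as natural `A`-`B`-bimodules. -/
def IsRightD2 (φ : B →ₐ[K] A) : Prop :=
  IsCentrallyProjective (sqLeft φ) ((sqRight φ).comp (AlgHom.op φ)) (Algebra.lmul K A) (rightB φ)

/-- The endomorphisms of the left `B`-module `A`, as a subalgebra of `End_K A`. -/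
def endLeft (φ : B →ₐ[K] A) : Subalgebra K (Module.End K A) where
  carrier := {f | ∀ (b : B) (a : A), f (φ b * a) = φ b * f a}
  mul_mem' := fun {f g} hf hg b a => by
    simp only [Set.mem_ofPred_eq] at hf hg
    simp [hf, hg]
  add_mem' := fun {f g} hf hg b a => by
    simp only [Set.mem_ofPred_eq] at hf hg
    simp [hf, hg, mul_add]
  algebraMap_mem' := fun k b a => by simp

/-- The endomorphisms of the `B`-`B`-bimodule `A`, as a subalgebra of `End_K A`. -/
def endBimod (φ : B →ₐ[K] A) : Subalgebra K (Module.End K A) where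
  carrier := {f | (∀ (b : B) (a : A), f (φ b * a) = φ b * f a) ∧
    ∀ (b : B) (a : A), f (a * φ b) = f a * φ b}
  mul_mem' := fun {f g} hf hg => by
    simp only [Set.mem_ofPred_eq] at hf hg
    exact ⟨fun b a => by simp [hf.1, hg.1], fun b a => by simp [hf.2, hg.2]⟩
  add_mem' := fun {f g} hf hg => by
    simp only [Set.mem_ofPred_eq] at hf hg
    exact ⟨fun b a => by simp [hf.1, hg.1, mul_add], fun b a => by simp [hf.2, hg.2, add_mul]⟩
  algebraMap_mem' := fun k => ⟨fun b a => by simp, fun b a => by simp⟩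

theorem endBimod_le (φ : B →ₐ[K] A) : endBimod φ ≤ endLeft φ := fun _ hf => hf.1

/-- The centralizer `R = C_A(B)` of the extension. -/
def R (φ : B →ₐ[K] A) : Type _ := Subalgebra.centralizer K (Set.range φ)

instance (φ : B →ₐ[K] A) : Ring (R φ) :=
  inferInstanceAs (Ring (Subalgebra.centralizer K (Set.range φ)))

instance (φ : B →ₐ[K] A) : Algebra K (R φ) :=
  inferInstanceAs (Algebra K (Subalgebra.centralizer K (Set.range φ)))

/-- The inclusion of `R` in `A`. -/
def R.val (φ : B →ₐ[K] A) : R φ →ₐ[K] A := (Subalgebra.centralizer K (Set.range φ)).val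

theorem R.comm {φ : B →ₐ[K] A} (r : R φ) (b : B) : φ b * R.val φ r = R.val φ r * φ b :=
  r.2 _ ⟨b, rfl⟩

/-- The left endomorphism algebra `ℰ = End _B A`, with composition as product. -/
def E (φ : B →ₐ[K] A) : Type _ := endLeft φ

instance (φ : B →ₐ[K] A) : Ring (E φ) := inferInstanceAs (Ring (endLeft φ))

instance (φ : B →ₐ[K] A) : Algebra K (E φ) := inferInstanceAs (Algebra K (endLeft φ))

/-- The elements of `ℰ` as endomorphisms of `A`. -/
def E.val (φ : B →ₐ[K] A) : E φ →ₐ[K] Module.End K A := (endLeft φ).val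

theorem E.val_injective (φ : B →ₐ[K] A) : Function.Injective (E.val φ) := Subtype.val_injective

theorem E.map_left {φ : B →ₐ[K] A} (f : E φ) (b : B) (a : A) :
    E.val φ f (φ b * a) = φ b * E.val φ f a := f.2 b a

/-- The bimodule endomorphism algebra `S = End _B A_B`, with composition as product. -/
def S (φ : B →ₐ[K] A) : Type _ := endBimod φ

instance (φ : B →ₐ[K] A) : Ring (S φ) := inferInstanceAs (Ring (endBimod φ))

instance (φ : B →ₐ[K] A) : Algebra K (S φ) := inferInstanceAs (Algebra K (endBimod φ))

/-- The elements of `S` as endomorphisms of `A`. -/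
def S.val (φ : B →ₐ[K] A) : S φ →ₐ[K] Module.End K A := (endBimod φ).val

theorem S.val_injective (φ : B →ₐ[K] A) : Function.Injective (S.val φ) := Subtype.val_injective

theorem S.map_left {φ : B →ₐ[K] A} (f : S φ) (b : B) (a : A) :
    S.val φ f (φ b * a) = φ b * S.val φ f a := f.2.1 b a

theorem S.map_right {φ : B →ₐ[K] A} (f : S φ) (b : B) (a : A) :
    S.val φ f (a * φ b) = S.val φ f a * φ b := f.2.2 b a

/-- The inclusion of `S` in `ℰ`. -/
def S.toE (φ : B →ₐ[K] A) : S φ →ₐ[K] E φ := Subalgebra.inclusion (endBimod_le φ)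

@[simp]
theorem S.val_toE {φ : B →ₐ[K] A} (f : S φ) : E.val φ (S.toE φ f) = S.val φ f := rfl

/-- `T = (A ⊗_B A)^B`, the `B`-central elements of the tensor-square. -/
def centralSq (φ : B →ₐ[K] A) : Submodule K (TensorSq φ) where
  carrier := {u | ∀ b : B, sqLeft φ (φ b) u = sqRight φ (MulOpposite.op (φ b)) u}
  add_mem' := fun {u v} hu hv b => by
    simp only [Set.mem_ofPred_eq] at hu hv
    simp [hu, hv]
  zero_mem' := fun b => by simp
  smul_mem' := fun k u hu b => by
    simp only [Set.mem_ofPred_eq] at hu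
    simp [hu]

/-- Left multiplications `λ : R → S`, `λ(r)(x) = r x`. -/
def lam (φ : B →ₐ[K] A) : R φ →ₐ[K] S φ :=
  AlgHom.codRestrict ((Algebra.lmul K A).comp (R.val φ)) (endBimod φ) (fun r =>
    ⟨fun b a => by simp [← mul_assoc, R.comm r b], fun b a => by simp [mul_assoc]⟩)

@[simp]
theorem lam_apply (φ : B →ₐ[K] A) (r : R φ) (x : A) :
    S.val φ (lam φ r) x = R.val φ r * x := rfl

/-- Right multiplications `ρ : R^op → S`, `ρ(r)(x) = x r`. -/
def rho (φ : B →ₐ[K] A) : (R φ)ᵐᵒᵖ →ₐ[K] S φ :=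
  AlgHom.codRestrict ((rightMul K A).comp (AlgHom.op (R.val φ))) (endBimod φ) (fun r =>
    ⟨fun b a => by simp [mul_assoc], fun b a => by simp [mul_assoc, R.comm r.unop b]⟩)

@[simp]
theorem rho_apply (φ : B →ₐ[K] A) (r : (R φ)ᵐᵒᵖ) (x : A) :
    S.val φ (rho φ r) x = x * R.val φ r.unop := rfl

/-- Left multiplications `λ : R → ℰ`. -/
def lamLeft (φ : B →ₐ[K] A) : R φ →ₐ[K] E φ := (S.toE φ).comp (lam φ)

/-- Right multiplications `ρ : A^op → ℰ`, `ρ(a)(x) = x a`. -/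
def rhoLeft (φ : B →ₐ[K] A) : Aᵐᵒᵖ →ₐ[K] E φ :=
  AlgHom.codRestrict (rightMul K A) (endLeft φ) (fun _ b a => by simp [mul_assoc])

@[simp]
theorem rhoLeft_apply (φ : B →ₐ[K] A) (a : Aᵐᵒᵖ) (x : A) :
    E.val φ (rhoLeft φ a) x = x * a.unop := rfl

/-- The source map `λ` and target map `ρ` of `S` over `R`. -/
def sourceTarget (φ : B →ₐ[K] A) : SourceTarget K (R φ) (S φ) where
  s := lam φ
  t := rho φ
  comm := fun r r' => S.val_injective φ (by
    ext a
    simp [mul_assoc])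

/-- The counit `ε(α) = α(1)` of `S`. -/
def counit (φ : B →ₐ[K] A) : S φ →ₗ[K] R φ :=
  LinearMap.codRestrict (Subalgebra.toSubmodule (Subalgebra.centralizer K (Set.range φ)))
    ((LinearMap.applyₗ (1 : A)) ∘ₗ (S.val φ).toLinearMap) (fun α => by
      rintro _ ⟨b, rfl⟩
      have h1 := S.map_left α b 1
      have h2 := S.map_right α b 1
      rw [mul_one] at h1
      rw [one_mul] at h2
      exact h1.symm.trans h2)

@[simp]
theorem counit_apply (φ : B →ₐ[K] A) (α : S φ) : R.val φ (counit φ α) = S.val φ α 1 := rfl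

/-- `u ↦ u¹ f(u² -)`, as a linear map `A ⊗_B A → End_K A`, for `f` in `ℰ`. -/
def actAux (φ : B →ₐ[K] A) (f : E φ) : TensorSq φ →ₗ[K] Module.End K A :=
  BalTensor.lift
    (LinearMap.mk₂ K
      (fun a a' => LinearMap.mulLeft K a ∘ₗ E.val φ f ∘ₗ LinearMap.mulLeft K a')
      (fun a b c => by ext; simp [add_mul])
      (fun k a c => by ext; simp)
      (fun a b c => by ext; simp [add_mul, mul_add])
      (fun k a c => by ext; simp))
    (fun b a a' => by
      ext x
      simp [E.map_left])

@[simp]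
theorem actAux_mk (φ : B →ₐ[K] A) (f : E φ) (a a' x : A) :
    actAux φ f (BalTensor.mk (rightB φ) (leftB φ) a a') x = a * E.val φ f (a' * x) := by
  simp [actAux]

theorem actAux_sqLeft (φ : B →ₐ[K] A) (f : E φ) (c : A) (u : TensorSq φ) (x : A) :
    actAux φ f (sqLeft φ c u) x = c * actAux φ f u x := by
  have h : actAux φ f ∘ₗ sqLeft φ c = (LinearMap.mulLeft K c).compRight K ∘ₗ actAux φ f :=
    BalTensor.hom_ext fun m n => by
      ext y
      simp [mul_assoc]
  exact LinearMap.congr_fun (LinearMap.congr_fun h u) x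

theorem actAux_sqRight (φ : B →ₐ[K] A) (f : E φ) (c : A) (u : TensorSq φ) (x : A) :
    actAux φ f (sqRight φ (MulOpposite.op c) u) x = actAux φ f u (c * x) := by
  have h : actAux φ f ∘ₗ sqRight φ (MulOpposite.op c) =
      LinearMap.lcomp K A (LinearMap.mulLeft K c) ∘ₗ actAux φ f :=
    BalTensor.hom_ext fun m n => by
      ext y
      simp [mul_assoc]
  exact LinearMap.congr_fun (LinearMap.congr_fun h u) x

/-- The linear map `f ↦ u¹ f(u² -)` from `ℰ` to `End_K A`, for `u` in `A ⊗_B A`. -/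
def actEnd (φ : B →ₐ[K] A) (u : TensorSq φ) : E φ →ₗ[K] Module.End K A where
  toFun := fun f => actAux φ f u
  map_add' := fun f g => by
    have h : actAux φ (f + g) = actAux φ f + actAux φ g :=
      BalTensor.hom_ext fun m n => by ext y; simp [mul_add]
    rw [h, LinearMap.add_apply]
  map_smul' := fun k f => by
    have h : actAux φ (k • f) = k • actAux φ f :=
      BalTensor.hom_ext fun m n => by ext y; simp
    rw [h, LinearMap.smul_apply, RingHom.id_apply]

/-- The action `f ↦ u¹ f(u² -)` of `u` in `T` on `f` in `ℰ`. -/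
def act (φ : B →ₐ[K] A) (u : centralSq φ) : E φ →ₗ[K] E φ :=
  LinearMap.codRestrict (Subalgebra.toSubmodule (endLeft φ)) (actEnd φ u) (fun f b a =>
    (actAux_sqRight φ f (φ b) u a).symm.trans (by rw [← u.2 b, actAux_sqLeft]; rfl))

@[simp]
theorem act_apply (φ : B →ₐ[K] A) (u : centralSq φ) (f : E φ) :
    E.val φ (act φ u f) = actAux φ f u := rfl

/-- The action `α ↦ u¹ α(u² -)` of `u` in `T` on `α` in `S`. -/
def actBimod (φ : B →ₐ[K] A) (u : centralSq φ) : S φ →ₗ[K] S φ :=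
  LinearMap.codRestrict (Subalgebra.toSubmodule (endBimod φ))
    ((actEnd φ u).comp (S.toE φ).toLinearMap) (fun α =>
      ⟨(act φ u (S.toE φ α)).2, fun b a => by
        have h : LinearMap.lcomp K A (LinearMap.mulRight K (φ b)) ∘ₗ actAux φ (S.toE φ α) =
            (LinearMap.mulRight K (φ b)).compRight K ∘ₗ actAux φ (S.toE φ α) :=
          BalTensor.hom_ext fun m n => by
            ext y
            simp [← mul_assoc, S.map_right]
        exact LinearMap.congr_fun (LinearMap.congr_fun h u) a⟩)

@[simp]
theorem actBimod_apply (φ : B →ₐ[K] A) (u : centralSq φ) (α : S φ) :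
    S.val φ (actBimod φ u α) = actAux φ (S.toE φ α) u := rfl

/-- A right D2 quasibase: finitely many `γ_j ∈ S` and `u_j ∈ T` with
`a ⊗ a' = ∑_j a γ_j(a') u_j` in `A ⊗_B A` for all `a, a'`. -/
structure RightD2Quasibase (φ : B →ₐ[K] A) where
  n : ℕ
  γ : Fin n → S φ
  u : Fin n → centralSq φ
  eq_sum : ∀ a a' : A, BalTensor.mk (rightB φ) (leftB φ) a a' =
    ∑ j, sqLeft φ (a * S.val φ (γ j) a') (u j)

/-- The comultiplication `Δ(α) = ∑_j γ_j ⊗ u_j¹ α(u_j² -)` of `S`. -/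
def RightD2Quasibase.comul {φ : B →ₐ[K] A} (Q : RightD2Quasibase φ) :
    S φ →ₗ[K] (sourceTarget φ).Tensor (sourceTarget φ).s :=
  ∑ j, ((sourceTarget φ).tmul (sourceTarget φ).s (Q.γ j)).comp (actBimod φ (Q.u j))

/-- The coaction `ϱ(f) = ∑_j γ_j ⊗ u_j¹ f(u_j² -)` of `S` on `ℰ`. -/
def RightD2Quasibase.coaction {φ : B →ₐ[K] A} (Q : RightD2Quasibase φ) :
    E φ →ₗ[K] (sourceTarget φ).Tensor (lamLeft φ) :=
  ∑ j, ((sourceTarget φ).tmul (lamLeft φ) (Q.γ j)).comp (act φ (Q.u j))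

end AlgExt

end

/-!
An element `∑ α ⊗ f` of `S ⊗_R ℰ` is determined by the map `(a, a') ↦ ∑ α(a) f(a')`, and more
generally `S ⊗_R N` is separated by the maps `α ⊗ n ↦ α(a) ℓ(n)` whenever the left `R`-module `N` is
separated by left `R`-linear maps `ℓ : N → A` (`RightD2Quasibase.eq_of_pairing_eq`). This is because
a quasibase makes `S` a finitely generated projective right `R`-module, with generators `γ_j` and
coordinates `α ↦ u_j¹ α(u_j²)`, so that `z` is recovered from its coordinates
(`RightD2Quasibase.sum_mk_coord`), and these are read off from the maps in question
(`apply_coord`). Applying this twice separates `S ⊗_R (S ⊗_R ℰ)` by trilinear maps on `A`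
(`RightD2Quasibase.eq_of_eval₃_eq`).

Applying `u ↦ u¹ f(u² a')` to the quasibase identity `1 ⊗ a = ∑ γ_j(a) u_j` gives
`f(a a') = ∑ γ_j(a) u_j¹ f(u_j² a')` (`RightD2Quasibase.sum_mul_actAux`). Hence `ϱ(f)` corresponds to `(a, a') ↦ f(a a')`, and likewise
`Δ(α)` to `(a, a') ↦ α(a a')`. Neither depends on the quasibase, and the axioms of a
bialgebroid and of a comodule algebra become the unit and associativity laws of `A`. The equation
`ϱ(f) = 1 ⊗ f` becomes `f(a a') = a f(a')`, that is, `f = ρ(f(1))`.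

The Galois map sends `f ⊗ g` to `(a, a') ↦ f(a g(a'))`. Since `a ⊗ a' = ∑ a γ_j(a') u_j`, a bilinear
map `F` coming from `S ⊗_R ℰ` satisfies `F(a, a') = ∑ F_j(a γ_j(a'))` with
`F_j(x) = F(x u_j¹, u_j²)`, which exhibits the inverse `F ↦ ∑ F_j ⊗ γ_j`
(`RightD2Quasibase.isGalois`).
-/

noncomputable section

namespace AlgExt

variable {K A B : Type*} [CommRing K] [Ring A] [Algebra K A] [Ring B] [Algebra K B]
  {φ : B →ₐ[K] A}

/-! ### Existence of quasibases -/

/-- The components of the two bimodule maps `A ⊗_B A → A^n → A ⊗_B A` that split, composed with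
`a' ↦ 1 ⊗ a'` and evaluated at the standard basis vectors, form a quasibase. -/
theorem IsRightD2.nonempty_quasibase (hφ : IsRightD2 φ) : Nonempty (RightD2Quasibase φ) := by
  obtain ⟨n, i, p, hiA, hiB, hpA, hpB, hpi⟩ := hφ
  have hpA' (a : A) (j : Fin n) : p (Pi.single j a) = sqLeft φ a (p (Pi.single j 1)) := by
    rw [← hpA]
    congr 1
    ext k
    by_cases h : k = j
    · subst h; simp
    · simp [h]
  have hpB' (b : B) (j : Fin n) : p (Pi.single j (φ b)) =
      sqRight φ (MulOpposite.op (φ b)) (p (Pi.single j 1)) := by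
    refine Eq.trans ?_ (hpB (MulOpposite.op b) (Pi.single j 1))
    congr 1
    ext k
    by_cases h : k = j
    · subst h; simp
    · simp [h]
  refine ⟨⟨n, fun j => ⟨LinearMap.proj j ∘ₗ i ∘ₗ BalTensor.mk (rightB φ) (leftB φ) 1, ?_, ?_⟩,
    fun j => ⟨p (Pi.single j 1), fun b => ?_⟩, fun a a' => ?_⟩⟩
  · intro b a
    have h1 : BalTensor.mk (rightB φ) (leftB φ) 1 (φ b * a) =
        sqLeft φ (φ b) (BalTensor.mk (rightB φ) (leftB φ) 1 a) := by
      refine (BalTensor.mk_smul (p := rightB φ) (q := leftB φ) b 1 a).symm.trans ?_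
      simp
    simp only [LinearMap.comp_apply, LinearMap.proj_apply, h1, hiA]
    rfl
  · intro b a
    exact congrFun (hiB (MulOpposite.op b) (BalTensor.mk (rightB φ) (leftB φ) 1 a)) j
  · rw [← hpA', hpB']
  · have h1 : BalTensor.mk (rightB φ) (leftB φ) a a' =
        sqLeft φ a (BalTensor.mk (rightB φ) (leftB φ) 1 a') := by simp
    rw [← hpi (BalTensor.mk (rightB φ) (leftB φ) a a'), ← Finset.univ_sum_single
      (i (BalTensor.mk (rightB φ) (leftB φ) a a')), map_sum]
    refine Finset.sum_congr rfl fun j _ => ?_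
    rw [hpA', h1, hiA]
    rfl

/-! ### Reconstruction from a quasibase -/

theorem actAux_rhoLeft_mul (c : A) (f : E φ) (u : TensorSq φ) (x : A) :
    actAux φ (rhoLeft φ (MulOpposite.op c) * f) u x = actAux φ f u x * c := by
  have h : actAux φ (rhoLeft φ (MulOpposite.op c) * f) =
      (LinearMap.mulRight K c).compRight K ∘ₗ actAux φ f :=
    BalTensor.hom_ext fun m n => by
      ext y
      simp [mul_assoc]
  exact LinearMap.congr_fun (LinearMap.congr_fun h u) x

theorem RightD2Quasibase.sum_mul_actAux (Q : RightD2Quasibase φ) (f : E φ) (a x : A) :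
    ∑ j, S.val φ (Q.γ j) a * actAux φ f (Q.u j) x = E.val φ f (a * x) := by
  have h := congrArg (fun u => actAux φ f u x) (Q.eq_sum 1 a)
  simpa [actAux_sqLeft] using h.symm

theorem R.val_injective : Function.Injective (R.val φ) := Subtype.val_injective

/-- `u ↦ u¹ α(u²)` for `u ∈ T` and `α ∈ S`, an element of the centralizer. -/
def centralEval (u : centralSq φ) : S φ →ₗ[K] R φ := counit φ ∘ₗ actBimod φ u

theorem val_centralEval (u : centralSq φ) (α : S φ) :
    R.val φ (centralEval u α) = actAux φ (S.toE φ α) u 1 := rfl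

theorem centralEval_rho_mul (u : centralSq φ) (r : (R φ)ᵐᵒᵖ) (α : S φ) :
    centralEval u (rho φ r * α) = centralEval u α * r.unop := by
  refine R.val_injective ?_
  rw [map_mul (R.val φ), val_centralEval, val_centralEval, ← actAux_rhoLeft_mul]
  rfl

/-- The `γ_j` generate `S` as a right `R`-module, with coordinate functions `α ↦ u_j¹ α(u_j²)`. -/
theorem RightD2Quasibase.sum_rho_mul (Q : RightD2Quasibase φ) (α : S φ) :
    ∑ j, rho φ (MulOpposite.op (centralEval (Q.u j) α)) * Q.γ j = α := by
  refine S.val_injective φ (LinearMap.ext fun a => ?_)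
  simp only [map_sum, LinearMap.sum_apply, map_mul, Module.End.mul_apply, rho_apply,
    MulOpposite.unop_op, val_centralEval, Q.sum_mul_actAux, mul_one, S.val_toE]

@[simp]
theorem sourceTarget_t : (sourceTarget φ).t = rho φ := rfl

@[simp]
theorem S.val_source (r : R φ) (x : A) : S.val φ ((sourceTarget φ).s r) x = R.val φ r * x := rfl

theorem E.val_lamLeft (r : R φ) (x : A) : E.val φ (lamLeft φ r) x = R.val φ r * x := rfl

section Pairing

variable {N : Type*} [AddCommGroup N] [Module K N] {q : R φ →ₐ[K] Module.End K N}

/-- The coordinate function `α ⊗ n ↦ u¹ α(u²) n` from `S ⊗_R N` to `N`. -/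
def coord (q : R φ →ₐ[K] Module.End K N) (u : centralSq φ) :
    BalTensor (sourceTarget φ).rightModule q →ₗ[K] N :=
  BalTensor.lift (q.toLinearMap ∘ₗ centralEval u) (fun r α n => by
    simp [centralEval_rho_mul])

theorem coord_mk (u : centralSq φ) (α : S φ) (n : N) :
    coord q u (BalTensor.mk (sourceTarget φ).rightModule q α n) = q (centralEval u α) n :=
  BalTensor.lift_mk _ _ _ _

theorem RightD2Quasibase.sum_mk_coord (Q : RightD2Quasibase φ)
    (z : BalTensor (sourceTarget φ).rightModule q) :
    ∑ j, BalTensor.mk (sourceTarget φ).rightModule q (Q.γ j) (coord q (Q.u j) z) = z := by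
  have h : ∑ j, BalTensor.mk (sourceTarget φ).rightModule q (Q.γ j) ∘ₗ coord q (Q.u j) =
      LinearMap.id :=
    BalTensor.hom_ext fun α n => by
      simp only [LinearMap.sum_apply, LinearMap.comp_apply, coord_mk, ← BalTensor.mk_smul]
      rw [← LinearMap.sum_apply, ← map_sum]
      simp [Q.sum_rho_mul]
  simpa using LinearMap.congr_fun h z

/-- For a left `R`-linear map `ℓ : N → A`, the map from `S ⊗_R N` to `ℰ` taking `α ⊗ n` to
`a ↦ α(a) ℓ(n)`. -/
def pairing (ℓ : N →ₗ[K] A) (hℓ : ∀ r n, ℓ (q r n) = R.val φ r * ℓ n) :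
    BalTensor (sourceTarget φ).rightModule q →ₗ[K] E φ :=
  BalTensor.lift
    ((LinearMap.mul K (E φ)).flip.compl₁₂ (S.toE φ).toLinearMap
      ((rhoLeft φ).toLinearMap ∘ₗ (MulOpposite.opLinearEquiv K).toLinearMap ∘ₗ ℓ))
    (fun r α n => E.val_injective φ (LinearMap.ext fun a => by
      simp [hℓ, mul_assoc]))

theorem pairing_mk (ℓ : N →ₗ[K] A) (hℓ : ∀ r n, ℓ (q r n) = R.val φ r * ℓ n) (α : S φ) (n : N) :
    pairing ℓ hℓ (BalTensor.mk (sourceTarget φ).rightModule q α n) =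
      rhoLeft φ (MulOpposite.op (ℓ n)) * S.toE φ α :=
  BalTensor.lift_mk _ _ _ _

/-- The pairings of `z` with `ℓ` determine the values of `ℓ` on the coordinates of `z`. -/
theorem apply_coord (ℓ : N →ₗ[K] A) (hℓ : ∀ r n, ℓ (q r n) = R.val φ r * ℓ n) (u : centralSq φ)
    (z : BalTensor (sourceTarget φ).rightModule q) :
    ℓ (coord q u z) = actAux φ (pairing ℓ hℓ z) u 1 := by
  have h : ℓ ∘ₗ coord q u = LinearMap.applyₗ (1 : A) ∘ₗ actEnd φ u ∘ₗ pairing ℓ hℓ :=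
    BalTensor.hom_ext fun α n => by
      simp only [LinearMap.comp_apply, coord_mk, pairing_mk, hℓ, val_centralEval]
      exact (actAux_rhoLeft_mul _ _ _ _).symm
  exact LinearMap.congr_fun h z

/-- If `N` is separated by left `R`-linear maps `ℓ i : N → A`, then `S ⊗_R N` is separated by the
maps `α ⊗ n ↦ α(a) (ℓ i)(n)`. -/
theorem RightD2Quasibase.eq_of_pairing_eq (Q : RightD2Quasibase φ) {ι : Sort*}
    (ℓ : ι → N →ₗ[K] A) (hℓ : ∀ i r n, ℓ i (q r n) = R.val φ r * ℓ i n)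
    (hsep : ∀ n n' : N, (∀ i, ℓ i n = ℓ i n') → n = n')
    {z w : BalTensor (sourceTarget φ).rightModule q}
    (h : ∀ i, pairing (ℓ i) (hℓ i) z = pairing (ℓ i) (hℓ i) w) : z = w := by
  rw [← Q.sum_mk_coord z, ← Q.sum_mk_coord w]
  refine Finset.sum_congr rfl fun j _ => ?_
  congr 1
  exact hsep _ _ fun i => by rw [apply_coord _ (hℓ i), apply_coord _ (hℓ i), h i]

end Pairing

/-! ### Elements of `S ⊗_R C` as bilinear maps -/

section Eval

variable {C : Type*} [Ring C] [Algebra K C] {η : R φ →ₐ[K] C} {v : C →ₐ[K] Module.End K A}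

/-- For an algebra `C` acting on `A` by `v`, compatibly with left multiplications by `R`, the value
at `(a, a')` of the bilinear map attached to an element of `S ⊗_R C`:
`α ⊗ c` is sent to `α(a) c(a')`. -/
def eval (hv : ∀ r x, v (η r) x = R.val φ r * x) (a a' : A) :
    (sourceTarget φ).Tensor η →ₗ[K] A :=
  LinearMap.applyₗ a ∘ₗ (E.val φ).toLinearMap ∘ₗ
    pairing (LinearMap.applyₗ a' ∘ₗ v.toLinearMap) (fun r c => by simp [hv])

variable (hv : ∀ r x, v (η r) x = R.val φ r * x)

@[simp]
theorem eval_tmul (a a' : A) (α : S φ) (c : C) :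
    eval hv a a' ((sourceTarget φ).tmul η α c) = S.val φ α a * v c a' := by
  simp [eval, pairing_mk]

theorem RightD2Quasibase.eq_of_eval_eq (Q : RightD2Quasibase φ) (hinj : Function.Injective v)
    {z w : (sourceTarget φ).Tensor η} (h : ∀ a a', eval hv a a' z = eval hv a a' w) : z = w :=
  Q.eq_of_pairing_eq (fun a' => LinearMap.applyₗ a' ∘ₗ v.toLinearMap)
    (fun a' r c => by simp [hv]) (fun c c' hc => hinj (LinearMap.ext hc))
    (fun a' => E.val_injective φ (LinearMap.ext fun a => h a a'))

theorem eval_tensorLeft (a a' : A) (r : R φ) (z : (sourceTarget φ).Tensor η) :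
    eval hv a a' ((sourceTarget φ).tensorLeft η r z) = R.val φ r * eval hv a a' z := by
  have h : eval hv a a' ∘ₗ (sourceTarget φ).tensorLeft η r =
      LinearMap.mulLeft K (R.val φ r) ∘ₗ eval hv a a' :=
    SourceTarget.tensor_ext fun α c => by simp [mul_assoc]
  exact LinearMap.congr_fun h z

theorem eval_mulPure (a a' : A) (y : S φ) (d : C) (z : (sourceTarget φ).Tensor η) :
    eval hv a a' ((sourceTarget φ).mulPure η y d z) = eval hv (S.val φ y a) (v d a') z := by
  have h : eval hv a a' ∘ₗ (sourceTarget φ).mulPure η y d = eval hv (S.val φ y a) (v d a') :=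
    SourceTarget.tensor_ext fun α c => by simp
  exact LinearMap.congr_fun h z

theorem apply_counitTensor (z : (sourceTarget φ).Tensor η)
    (hε : ∀ (r : (R φ)ᵐᵒᵖ) (x : S φ),
      counit φ ((sourceTarget φ).t r * x) = counit φ x * r.unop) (x : A) :
    v ((sourceTarget φ).counitTensor η (counit φ) hε z) x = eval hv 1 x z := by
  have h : LinearMap.applyₗ x ∘ₗ v.toLinearMap ∘ₗ
      (sourceTarget φ).counitTensor η (counit φ) hε = eval hv 1 x :=
    SourceTarget.tensor_ext fun α c => by
      simp [SourceTarget.counitTensor, hv]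
  exact LinearMap.congr_fun h z

/-- The value at `(a, a', a'')` of the trilinear map attached to an element of `S ⊗_R (S ⊗_R C)`:
`α ⊗ (β ⊗ c)` is sent to `α(a) β(a') c(a'')`. -/
def eval₃ (a a' a'' : A) : (sourceTarget φ).Tensor₃ η →ₗ[K] A :=
  LinearMap.applyₗ a ∘ₗ (E.val φ).toLinearMap ∘ₗ
    pairing (eval hv a' a'') (eval_tensorLeft hv a' a'')

@[simp]
theorem eval₃_mk (a a' a'' : A) (α : S φ) (z : (sourceTarget φ).Tensor η) :
    eval₃ hv a a' a'' (BalTensor.mk (sourceTarget φ).rightModule ((sourceTarget φ).tensorLeft η)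
      α z) = S.val φ α a * eval hv a' a'' z := by
  simp [eval₃, pairing_mk]

theorem RightD2Quasibase.eq_of_eval₃_eq (Q : RightD2Quasibase φ) (hinj : Function.Injective v)
    {z w : (sourceTarget φ).Tensor₃ η}
    (h : ∀ a a' a'', eval₃ hv a a' a'' z = eval₃ hv a a' a'' w) : z = w :=
  Q.eq_of_pairing_eq (fun s : A × A => eval hv s.1 s.2)
    (fun s => eval_tensorLeft hv s.1 s.2)
    (fun _ _ hz => Q.eq_of_eval_eq hv hinj fun a a' => hz (a, a'))
    (fun s => E.val_injective φ (LinearMap.ext fun a => h a s.1 s.2))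

end Eval

/-! ### Comodule axioms for coactions dual to the multiplication of `A` -/

section Coaction

variable {C : Type*} [Ring C] [Algebra K C] {η : R φ →ₐ[K] C} {v : C →ₐ[K] Module.End K A}
  (hv : ∀ r x, v (η r) x = R.val φ r * x) {δ : C →ₗ[K] (sourceTarget φ).Tensor η}
  (Q : RightD2Quasibase φ) (hinj : Function.Injective v)
  (hδ : ∀ c a a', eval hv a a' (δ c) = v c (a * a'))

include hinj hδ

theorem counit_coact_of_eval (hε : ∀ (r : (R φ)ᵐᵒᵖ) (x : S φ),
      counit φ ((sourceTarget φ).t r * x) = counit φ x * r.unop) (c : C) :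
    (sourceTarget φ).counitTensor η (counit φ) hε (δ c) = c :=
  hinj (LinearMap.ext fun x => by rw [apply_counitTensor hv, hδ, one_mul])

include Q

theorem coact_left_of_eval (r : R φ) (c : C) :
    δ (η r * c) = (sourceTarget φ).tensorLeft η r (δ c) :=
  Q.eq_of_eval_eq hv hinj fun a a' => by simp [hδ, eval_tensorLeft, hv]

theorem coact_one_of_eval : δ 1 = (sourceTarget φ).tmul η 1 1 :=
  Q.eq_of_eval_eq hv hinj fun a a' => by simp [hδ]

theorem takeuchi_of_eval (c : C) : (sourceTarget φ).IsTakeuchi η (δ c) := fun r =>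
  Q.eq_of_eval_eq hv hinj fun a a' => by simp [hδ, eval_mulPure, hv, mul_assoc]

theorem coact_mul_of_eval (c d : C) (hc : (sourceTarget φ).IsTakeuchi η (δ c)) :
    δ (c * d) = (sourceTarget φ).tensorMul η (δ c) hc (δ d) :=
  Q.eq_of_eval_eq hv hinj fun a a' => by
    have h : eval hv a a' ∘ₗ (sourceTarget φ).tensorMul η (δ c) hc = v c ∘ₗ eval hv a a' :=
      SourceTarget.tensor_ext fun α e => by
        simp [eval_mulPure, hδ]
    rw [hδ, map_mul v, Module.End.mul_apply, ← hδ d]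
    exact (LinearMap.congr_fun h (δ d)).symm

theorem coassoc_of_eval {Δ : S φ →ₗ[K] (sourceTarget φ).Tensor (sourceTarget φ).s}
    (hΔ : ∀ α a a', eval S.val_source a a' (Δ α) = S.val φ α (a * a'))
    (hΔr : ∀ (r : (R φ)ᵐᵒᵖ) (x : S φ),
      Δ ((sourceTarget φ).t r * x) = (sourceTarget φ).tensorRight r (Δ x))
    (hδl : ∀ (r : R φ) (c : C), δ (η r * c) = (sourceTarget φ).tensorLeft η r (δ c)) (c : C) :
    (sourceTarget φ).comulTensor η Δ hΔr (δ c) = (sourceTarget φ).tensorCoact η δ hδl (δ c) :=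
  Q.eq_of_eval₃_eq hv hinj fun a a' a'' => by
    have happ (e : C) : eval₃ hv a a' a'' ∘ₗ (sourceTarget φ).appendTensor η e =
        LinearMap.mulRight K (v e a'') ∘ₗ eval S.val_source a a' :=
      SourceTarget.tensor_ext fun α β => by
        rw [LinearMap.comp_apply, SourceTarget.appendTensor_tmul, eval₃_mk, eval_tmul]
        simp [mul_assoc]
    have hl : eval₃ hv a a' a'' ∘ₗ (sourceTarget φ).comulTensor η Δ hΔr =
        eval hv (a * a') a'' :=
      SourceTarget.tensor_ext fun α e => by
        have h := LinearMap.congr_fun (happ e) (Δ α)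
        simp only [LinearMap.comp_apply, LinearMap.mulRight_apply, hΔ] at h
        have h' : (sourceTarget φ).comulTensor η Δ hΔr ((sourceTarget φ).tmul η α e) =
            (sourceTarget φ).appendTensor η e (Δ α) := BalTensor.lift_mk _ _ _ _
        rw [LinearMap.comp_apply, h', h, eval_tmul]
    have hr : eval₃ hv a a' a'' ∘ₗ (sourceTarget φ).tensorCoact η δ hδl =
        eval hv a (a' * a'') :=
      SourceTarget.tensor_ext fun α e => by
        have h' : (sourceTarget φ).tensorCoact η δ hδl ((sourceTarget φ).tmul η α e) =
            BalTensor.mk (sourceTarget φ).rightModule ((sourceTarget φ).tensorLeft η) α (δ e) :=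
          BalTensor.map_mk _ _ _ _ _ _
        rw [LinearMap.comp_apply, h', eval₃_mk, hδ, eval_tmul]
    have h1 := LinearMap.congr_fun hl (δ c)
    have h2 := LinearMap.congr_fun hr (δ c)
    simp only [LinearMap.comp_apply, hδ] at h1 h2
    rw [h1, h2, mul_assoc]

end Coaction

/-! ### The bialgebroid `S` and the comodule algebra `ℰ` -/

namespace RightD2Quasibase

variable (Q : RightD2Quasibase φ)

/-- Under the identification of `S ⊗_R S` with bilinear maps, `Δ(α)` is `(a, a') ↦ α(a a')`. -/
theorem eval_comul (α : S φ) (a a' : A) :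
    eval S.val_source a a' (Q.comul α) = S.val φ α (a * a') := by
  have h := Q.sum_mul_actAux (S.toE φ α) a a'
  simp only [comul, LinearMap.sum_apply, map_sum, LinearMap.comp_apply]
  exact (Finset.sum_congr rfl fun j _ => eval_tmul _ _ _ _ _).trans h

/-- Under the identification of `S ⊗_R ℰ` with bilinear maps, `ϱ(f)` is `(a, a') ↦ f(a a')`. -/
theorem eval_coaction (f : E φ) (a a' : A) :
    eval E.val_lamLeft a a' (Q.coaction f) = E.val φ f (a * a') := by
  have h := Q.sum_mul_actAux f a a'
  simp only [coaction, LinearMap.sum_apply, map_sum, LinearMap.comp_apply]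
  exact (Finset.sum_congr rfl fun j _ => eval_tmul _ _ _ _ _).trans h

theorem comul_eq (Q' : RightD2Quasibase φ) : Q.comul = Q'.comul :=
  LinearMap.ext fun α => Q.eq_of_eval_eq S.val_source (S.val_injective φ) fun a a' => by
    rw [eval_comul, eval_comul]

theorem coaction_eq (Q' : RightD2Quasibase φ) : Q.coaction = Q'.coaction :=
  LinearMap.ext fun f => Q.eq_of_eval_eq E.val_lamLeft (E.val_injective φ) fun a a' => by
    rw [eval_coaction, eval_coaction]

end RightD2Quasibase

theorem eval_tensorRight (a a' : A) (r : (R φ)ᵐᵒᵖ)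
    (z : (sourceTarget φ).Tensor (sourceTarget φ).s) :
    eval S.val_source a a' ((sourceTarget φ).tensorRight r z) =
      eval S.val_source a a' z * R.val φ r.unop := by
  have h : eval S.val_source a a' ∘ₗ (sourceTarget φ).tensorRight r =
      LinearMap.mulRight K (R.val φ r.unop) ∘ₗ eval S.val_source a a' :=
    SourceTarget.tensor_ext fun α β => by
      rw [LinearMap.comp_apply, SourceTarget.tensorRight_tmul, eval_tmul]
      simp [mul_assoc]
  exact LinearMap.congr_fun h z

theorem val_tensorCounit (z : (sourceTarget φ).Tensor (sourceTarget φ).s)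
    (hε : ∀ (r : R φ) (x : S φ), counit φ ((sourceTarget φ).s r * x) = r * counit φ x) (a : A) :
    S.val φ ((sourceTarget φ).tensorCounit (counit φ) hε z) a = eval S.val_source a 1 z := by
  have h : LinearMap.applyₗ a ∘ₗ (S.val φ).toLinearMap ∘ₗ
      (sourceTarget φ).tensorCounit (counit φ) hε = eval S.val_source a 1 :=
    SourceTarget.tensor_ext fun α β => by
      rw [eval_tmul]
      simp [SourceTarget.tensorCounit]
  exact LinearMap.congr_fun h z

theorem RightD2Quasibase.isLeftBialgebroid (Q : RightD2Quasibase φ) :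
    (sourceTarget φ).IsLeftBialgebroid Q.comul (counit φ) where
  comul_left := coact_left_of_eval S.val_source Q (S.val_injective φ) Q.eval_comul
  comul_right r x := Q.eq_of_eval_eq S.val_source (S.val_injective φ) fun a a' => by
    simp [eval_tensorRight, Q.eval_comul]
  counit_left r x := R.val_injective (by simp)
  counit_right r x := R.val_injective (by simp)
  coassoc := coassoc_of_eval S.val_source Q (S.val_injective φ) Q.eval_comul Q.eval_comul _ _
  counit_comul := counit_coact_of_eval S.val_source (S.val_injective φ) Q.eval_comul _
  comul_counit x := S.val_injective φ (LinearMap.ext fun a => by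
    rw [val_tensorCounit, Q.eval_comul, mul_one])
  takeuchi := takeuchi_of_eval S.val_source Q (S.val_injective φ) Q.eval_comul
  comul_mul _ _ := coact_mul_of_eval S.val_source Q (S.val_injective φ) Q.eval_comul _ _ _
  comul_one := coact_one_of_eval S.val_source Q (S.val_injective φ) Q.eval_comul
  counit_one := R.val_injective (by simp)
  counit_mul_source x y := R.val_injective (by simp)
  counit_mul_target x y := R.val_injective (by simp)

theorem RightD2Quasibase.isLeftComoduleAlgebra (Q : RightD2Quasibase φ) :
    SourceTarget.IsLeftComoduleAlgebra Q.isLeftBialgebroid (lamLeft φ) Q.coaction where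
  coact_left := coact_left_of_eval E.val_lamLeft Q (E.val_injective φ) Q.eval_coaction
  coassoc := coassoc_of_eval E.val_lamLeft Q (E.val_injective φ) Q.eval_coaction Q.eval_comul _ _
  counit_coact := counit_coact_of_eval E.val_lamLeft (E.val_injective φ) Q.eval_coaction _
  coact_one := coact_one_of_eval E.val_lamLeft Q (E.val_injective φ) Q.eval_coaction
  takeuchi := takeuchi_of_eval E.val_lamLeft Q (E.val_injective φ) Q.eval_coaction
  coact_mul _ _ := coact_mul_of_eval E.val_lamLeft Q (E.val_injective φ) Q.eval_coaction _ _ _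

/-! ### Coinvariants -/

theorem RightD2Quasibase.coinvariants_eq (Q : RightD2Quasibase φ) :
    Q.isLeftComoduleAlgebra.coinvariants = (rhoLeft φ).range := by
  ext f
  change Q.coaction f = (sourceTarget φ).tmul (lamLeft φ) 1 f ↔ f ∈ (rhoLeft φ).range
  constructor
  · intro h
    refine ⟨MulOpposite.op (E.val φ f 1), E.val_injective φ (LinearMap.ext fun a => ?_)⟩
    have h1 := congrArg (eval E.val_lamLeft a 1) h
    rw [Q.eval_coaction, eval_tmul] at h1
    simpa using h1.symm
  · rintro ⟨a, rfl⟩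
    refine Q.eq_of_eval_eq E.val_lamLeft (E.val_injective φ) fun x y => ?_
    rw [Q.eval_coaction, eval_tmul]
    simp [mul_assoc]

theorem rhoLeft_injective : Function.Injective (rhoLeft φ) := fun a a' h => by
  have h1 := LinearMap.congr_fun (congrArg (E.val φ) h) 1
  simpa using h1

/-! ### The Galois map -/

/-- For `u ∈ A ⊗_B A`, the map `S ⊗_R ℰ → ℰ` taking `α ⊗ f` to `x ↦ α(x u¹) f(u²)`, linear
in `u`. -/
def slice (φ : B →ₐ[K] A) :
    TensorSq φ →ₗ[K] (sourceTarget φ).Tensor (lamLeft φ) →ₗ[K] E φ :=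
  BalTensor.lift
    (LinearMap.mk₂ K
      (fun a a' => LinearMap.mulRight K (rhoLeft φ (MulOpposite.op a)) ∘ₗ
        pairing (LinearMap.applyₗ a' ∘ₗ (E.val φ).toLinearMap)
          (fun r f => by simp [E.val_lamLeft]))
      (fun a b a' => by ext; simp [mul_add])
      (fun k a a' => by ext; simp)
      (fun a a' b' => SourceTarget.tensor_ext fun α f => by simp [pairing_mk, add_mul])
      (fun k a a' => SourceTarget.tensor_ext fun α f => by simp [pairing_mk]))
    (fun b a a' => SourceTarget.tensor_ext fun α f => E.val_injective φ (LinearMap.ext fun x => by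
      simp [pairing_mk, E.map_left, S.map_right]))

theorem val_slice_mk (a a' x : A) (z : (sourceTarget φ).Tensor (lamLeft φ)) :
    E.val φ (slice φ (BalTensor.mk (rightB φ) (leftB φ) a a') z) x =
      eval E.val_lamLeft (x * a) a' z := by
  simp [slice, eval]

theorem val_slice_sqLeft (c x : A) (u : TensorSq φ) (z : (sourceTarget φ).Tensor (lamLeft φ)) :
    E.val φ (slice φ (sqLeft φ c u) z) x = E.val φ (slice φ u z) (x * c) := by
  have h : LinearMap.applyₗ x ∘ₗ (E.val φ).toLinearMap ∘ₗ (slice φ).flip z ∘ₗ sqLeft φ c =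
      LinearMap.applyₗ (x * c) ∘ₗ (E.val φ).toLinearMap ∘ₗ (slice φ).flip z :=
    BalTensor.hom_ext fun a a' => by
      simp [val_slice_mk, mul_assoc]
  exact LinearMap.congr_fun h u

namespace RightD2Quasibase

variable (Q : RightD2Quasibase φ)

theorem slice_mulPure_coaction (u : TensorSq φ) (f g : E φ) :
    slice φ u ((sourceTarget φ).mulPure (lamLeft φ) 1 g (Q.coaction f)) =
      f * rhoLeft φ (MulOpposite.op (actAux φ g u 1)) := by
  refine E.val_injective φ (LinearMap.ext fun x => ?_)
  have h : LinearMap.applyₗ x ∘ₗ (E.val φ).toLinearMap ∘ₗ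
      (slice φ).flip ((sourceTarget φ).mulPure (lamLeft φ) 1 g (Q.coaction f)) =
      E.val φ f ∘ₗ LinearMap.mulLeft K x ∘ₗ LinearMap.applyₗ (1 : A) ∘ₗ actAux φ g :=
    BalTensor.hom_ext fun a a' => by
      simp [val_slice_mk, eval_mulPure, Q.eval_coaction, mul_assoc]
  exact LinearMap.congr_fun h u

/-- Every `g ∈ ℰ` is a combination of the `γ_j` with coefficients in `ρ(A)`. -/
theorem sum_rhoLeft_mul (g : E φ) :
    ∑ j, rhoLeft φ (MulOpposite.op (actAux φ g (Q.u j) 1)) * S.toE φ (Q.γ j) = g := by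
  refine E.val_injective φ (LinearMap.ext fun a => ?_)
  simp only [map_sum, LinearMap.sum_apply, map_mul, Module.End.mul_apply, rhoLeft_apply,
    MulOpposite.unop_op, Q.sum_mul_actAux, mul_one, S.val_toE]

/-- The inverse of the Galois map sends `z` to `∑_j z(- u_j) ⊗ γ_j`, where `z(- u)` is `slice φ u z`.
-/
theorem isGalois : Q.isLeftComoduleAlgebra.IsGalois := by
  set hE := Q.isLeftComoduleAlgebra
  let mkD : E φ →ₗ[K] E φ →ₗ[K] hE.CoinvTensor := BalTensor.mk _ _
  have hβ (f g : E φ) : hE.galoisMap (mkD f g) =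
      (sourceTarget φ).mulPure (lamLeft φ) 1 g (Q.coaction f) := BalTensor.lift_mk _ _ _ _
  let inv : (sourceTarget φ).Tensor (lamLeft φ) →ₗ[K] hE.CoinvTensor :=
    ∑ j, mkD.flip (S.toE φ (Q.γ j)) ∘ₗ slice φ (Q.u j)
  have hinv (z) : inv z = ∑ j, mkD (slice φ (Q.u j) z) (S.toE φ (Q.γ j)) := by
    simp [inv]
  -- `ρ(a)` is coinvariant, so it may be moved across the tensor sign.
  have hbal (f g : E φ) (a : A) : mkD (f * rhoLeft φ (MulOpposite.op a)) g =
      mkD f (rhoLeft φ (MulOpposite.op a) * g) :=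
    BalTensor.mk_smul (p := (rightMul K (E φ)).comp (AlgHom.op hE.coinvariants.val))
      (q := SourceTarget.leftModule hE.coinvariants.val)
      ⟨rhoLeft φ (MulOpposite.op a), Q.coinvariants_eq ▸ ⟨_, rfl⟩⟩ f g
  refine Function.bijective_iff_has_inverse.2 ⟨inv, fun w => ?_, fun z => ?_⟩
  · have h : inv ∘ₗ hE.galoisMap = LinearMap.id := BalTensor.hom_ext fun f g => by
      change inv (hE.galoisMap (mkD f g)) = mkD f g
      simp only [hβ, hinv, Q.slice_mulPure_coaction, hbal]
      rw [← map_sum, Q.sum_rhoLeft_mul]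
    exact LinearMap.congr_fun h w
  · refine Q.eq_of_eval_eq E.val_lamLeft (E.val_injective φ) fun a a' => ?_
    simp only [hinv, map_sum, hβ, eval_mulPure, Q.eval_coaction, map_one, Module.End.one_apply,
      S.val_toE]
    have h := congrArg (fun u => E.val φ (slice φ u z) 1) (Q.eq_sum a a')
    simp only [map_sum, LinearMap.sum_apply, val_slice_sqLeft, val_slice_mk, one_mul] at h
    exact h.symm

end RightD2Quasibase

end AlgExt

end

theorem mainTheorem1 {K A B : Type*} [CommRing K] [Ring A] [Algebra K A] [Ring B] [Algebra K B]
    (φ : B →ₐ[K] A) (hφ : AlgExt.IsRightD2 φ) :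
    Nonempty (AlgExt.RightD2Quasibase φ) ∧
    (∀ Q Q' : AlgExt.RightD2Quasibase φ, Q.comul = Q'.comul ∧ Q.coaction = Q'.coaction) ∧
    ∀ Q : AlgExt.RightD2Quasibase φ,
      ∃ (hS : (AlgExt.sourceTarget φ).IsLeftBialgebroid Q.comul (AlgExt.counit φ))
        (hE : SourceTarget.IsLeftComoduleAlgebra hS (AlgExt.lamLeft φ) Q.coaction),
        hE.coinvariants = (AlgExt.rhoLeft φ).range ∧
        (∃ e : Aᵐᵒᵖ ≃ₐ[K] hE.coinvariants,
          ∀ a : Aᵐᵒᵖ, (e a : AlgExt.E φ) = AlgExt.rhoLeft φ a) ∧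
        hE.IsGalois := by
  refine ⟨hφ.nonempty_quasibase, fun Q Q' => ⟨Q.comul_eq Q', Q.coaction_eq Q'⟩, fun Q =>
    ⟨Q.isLeftBialgebroid, Q.isLeftComoduleAlgebra, Q.coinvariants_eq, ?_, Q.isGalois⟩⟩
  exact ⟨(AlgEquiv.ofInjective (AlgExt.rhoLeft φ) AlgExt.rhoLeft_injective).trans
    (Subalgebra.equivOfEq _ _ Q.coinvariants_eq.symm), fun a => rfl⟩
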